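/- Let $(X,\rho)$ be a compact metric space, let $T:X\to X$ be a homeomorphism, and let $\mu$ be a $T$-invariant Borel probability measure on $X$. Write $\mathbb T=\{z\in\mathbb C:|z|=1\}$ and $[k]=\{0,1,\dots,k-1\}$. For $x\in X$, $j\in\mathbb Z$ and $r\ge 0$ put $$D_x(j,r)=\sup\{\rho(T^jx,T^jy): y\in X,\ \rho(x,y)\le r\}.$$ For $\theta\in\mathbb T$, $f\in C(X)$ (complex-valued) and a measurable set $C\subseteq X$ with $\mu(C)>0$ put $$\operatorname{Avg}^{\theta}_{[k]}f=\frac1k\sum_{j=0}^{k-1}\theta^j\,(f\circ T^j),\qquad \alpha_C(g)=\frac1{\mu(C)}\int_C g\,d\mu .$$ For each $j\in\mathbb Z$ let $\Delta^j:(0,1)\to(0,\infty)$ be a modulus of uniform equicontinuity for the family $\Xi^j=\{\xi^j:\xi\in\Xi\}$, where $\Xi$ is the family of constant functions $X\to\mathbb T$; that is, for all $\epsilon\in(0,1)$, $\xi\in\Xi$ and $x_1,x_2\in X$, if $\rho(x_1,x_2)\le\Delta^j(\epsilon)$ then $|\xi(x_1)^j-\xi(x_2)^j|\le\epsilon$.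 (Since the functions in $\Xi$ are constant, any functions $\Delta^j:(0,1)\to(0,\infty)$ may be used.) For each $x\in X$ and each integer $k\ge1$ let $C_k(x)$ be a measurable subset of $X$ with $x\in C_k(x)$ and $\mu(C_k(x))>0$, and suppose that for every $x\in X$, every $\delta>0$ and every $\epsilon\in(0,1)$, $$\lim_{k\to\infty}\frac{|\{j\in[k]: D_x(j,\operatorname{diam}(C_k(x)))>\delta\}|}{k}=0,\qquad \lim_{k\to\infty}\frac{|\{j\in[k]:\operatorname{diam}(C_k(x))>\Delta^j(\epsilon)\}|}{k}=0 .$$ Then for every $f\in C(X)$ there is a measurable set $X_f\subseteq X$ with $\mu(X_f)=1$ such that for all $x\in X_f$ and all $\theta\in\mathbb T$ the sequence $\bigl(\alpha_{C_k(x)}(\operatorname{Avg}^{\theta}_{[k]}f)\bigr)_{k=1}^\infty$ converges in $\mathbb C$. -/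

import Mathlib

open MeasureTheory Filter Topology

noncomputable section

namespace TemporoSpatial

/-- The functional `α_C(g) = (1 / μ(C)) ∫_C g dμ`, used for `μ(C) > 0`. -/
def spatialAvg {X : Type*} [MeasurableSpace X] (μ : Measure X) (C : Set X) (g : X → ℂ) : ℂ :=
  ((μ.real C : ℝ) : ℂ)⁻¹ * ∫ y in C, g y ∂μ

/-- The weighted average `Avg_F^ξ f = (1 / |F|) ∑_{j ∈ F} ξ^j · (f ∘ T^j)` for a finite nonempty
set `F` of integers and a weight `ξ : X → 𝕋`. -/
def weightedAvg {X : Type*} [TopologicalSpace X] (T : X ≃ₜ X) (F : Finset ℤ) (ξ : X → Circle)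
    (f : X → ℂ) (x : X) : ℂ :=
  (F.card : ℂ)⁻¹ * ∑ j ∈ F, ((ξ x ^ j : Circle) : ℂ) * f ((T ^ j) x)

/-- The set `[k] = {0, 1, …, k - 1}` of integers. -/
def initialSegment (k : ℕ) : Finset ℤ := Finset.Ico (0 : ℤ) (k : ℤ)

/-- `D_x(j, r) = sup {ρ(T^j x, T^j y) : y ∈ X, ρ(x, y) ≤ r}`. For `r ≥ 0` and `X` compact this is
the supremum of a nonempty bounded set. -/
def dilation {X : Type*} [MetricSpace X] (T : X ≃ₜ X) (x : X) (j : ℤ) (r : ℝ) : ℝ :=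
  sSup {d : ℝ | ∃ y : X, dist x y ≤ r ∧ d = dist ((T ^ j) x) ((T ^ j) y)}

/-- `Δ : (0, 1) → (0, ∞)` is a modulus of uniform continuity for `ξ`. -/
def IsModulusOfUniformContinuity {X : Type*} [MetricSpace X]
    (Δ : Set.Ioo (0 : ℝ) 1 → Set.Ioi (0 : ℝ)) (ξ : X → ℂ) : Prop :=
  ∀ (ε : Set.Ioo (0 : ℝ) 1) (x₁ x₂ : X), dist x₁ x₂ ≤ (Δ ε : ℝ) → ‖ξ x₁ - ξ x₂‖ ≤ (ε : ℝ)

/-- `Δ` is a modulus of uniform equicontinuity for the family `Ξ`. -/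
def IsModulusOfUniformEquicontinuity {X : Type*} [MetricSpace X]
    (Δ : Set.Ioo (0 : ℝ) 1 → Set.Ioi (0 : ℝ)) (Ξ : Set (X → ℂ)) : Prop :=
  ∀ ξ ∈ Ξ, IsModulusOfUniformContinuity Δ ξ

/-- The family `Ξ^j = {ξ^j : ξ ∈ Ξ}`, regarded as a family of complex-valued functions. -/
def powFamily {X : Type*} (Ξ : Set (X → Circle)) (j : ℤ) : Set (X → ℂ) :=
  {g | ∃ ξ ∈ Ξ, g = fun x => ((ξ x ^ j : Circle) : ℂ)}

/-- The family of all constant weights `x ↦ θ`, `θ ∈ 𝕋`. -/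
def constantWeights (X : Type*) : Set (X → Circle) :=
  {ξ | ∃ θ : Circle, ξ = fun _ => θ}

end TemporoSpatial

end

/-! For all but o(k) of the times j < k, the whole set `C k x` stays close to x under `T ^ j`. By
uniform continuity of f, the spatial average therefore differs from the twisted average at x by o(1)
(`norm_weightedAvg_sub_le`). It remains to find one null set outside which the twisted averages
converge for every θ: the Wiener–Wintner theorem, here without ergodicity.

Fix x and let `spectralMean` at M be the orbit mean of the squared modulus of the M-term twisted
average. If its infimum over M ≥ 1 at θ is 0, the averages at θ tend to 0, by smoothing and
Cauchy–Schwarz (`tendsto_twistedAvg_zero`). A large sieve inequality leaves only finitely many θ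
where it stays at least ε for all M ≥ 1 (`finite_setOf_le_spectralMean`), so the exceptional angles
are countable for each x.

They still depend on x, but only through T-invariant data. First hits starting from rational angles
enumerate them by countably many measurable invariant functions t. For each t, the pointwise ergodic
theorem for the skew product (x, z) ↦ (T x, t(x) + z) gives convergence almost everywhere
(`ae_exists_tendsto_twistedAvg`); countably many null sets are discarded. -/

namespace TemporoSpatial

/-! ### Upper limits of sequences with vanishing difference -/

section Limsup

theorem limsup_le_limsup_of_tendsto_sub {u v : ℕ → ℝ} {C : ℝ} (hu : ∀ n, |u n| ≤ C)
    (hv : ∀ n, |v n| ≤ C) (h : Tendsto (fun n => u n - v n) atTop (𝓝 0)) :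
    limsup u atTop ≤ limsup v atTop := by
  have bdd : ∀ w : ℕ → ℝ, (∀ n, |w n| ≤ C) → IsBoundedUnder (· ≤ ·) atTop w := fun w hw =>
    isBoundedUnder_of ⟨C, fun n => (abs_le.1 (hw n)).2⟩
  have cobdd : ∀ w : ℕ → ℝ, (∀ n, |w n| ≤ C) → IsCoboundedUnder (· ≤ ·) atTop w := fun w hw =>
    (isBoundedUnder_of ⟨-C, fun n => (abs_le.1 (hw n)).1⟩ :
      IsBoundedUnder (· ≥ ·) atTop w).isCoboundedUnder_flip
  refine le_of_forall_pos_le_add fun ε hε => ?_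
  have hlt : ∀ᶠ n in atTop, v n < limsup v atTop + ε / 2 :=
    eventually_lt_of_limsup_lt (by linarith) (bdd v hv)
  have hd : ∀ᶠ n in atTop, u n - v n < ε / 2 := h.eventually_lt_const (half_pos hε)
  refine limsup_le_of_le (cobdd u hu) ?_
  filter_upwards [hlt, hd] with n h1 h2
  linarith

theorem limsup_eq_limsup_of_tendsto_sub {u v : ℕ → ℝ} {C : ℝ} (hu : ∀ n, |u n| ≤ C)
    (hv : ∀ n, |v n| ≤ C) (h : Tendsto (fun n => u n - v n) atTop (𝓝 0)) :
    limsup u atTop = limsup v atTop :=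
  le_antisymm (limsup_le_limsup_of_tendsto_sub hu hv h)
    (limsup_le_limsup_of_tendsto_sub hv hu (by simpa using h.neg))

end Limsup

/-! ### The pointwise ergodic theorem for bounded real functions -/

section Birkhoff

variable {α : Type*} {T : α → α}

theorem norm_birkhoffAverage_le {E : Type*} [NormedAddCommGroup E] [NormedSpace ℝ E]
    {g : α → E} {C : ℝ} (hC : ∀ x, ‖g x‖ ≤ C) (n : ℕ) (x : α) :
    ‖birkhoffAverage ℝ T g n x‖ ≤ C := by
  have hC0 : 0 ≤ C := (norm_nonneg _).trans (hC x)
  rcases Nat.eq_zero_or_pos n with rfl | hn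
  · simpa using hC0
  have hn' : (0 : ℝ) < n := by exact_mod_cast hn
  have hsum : ‖birkhoffSum T g n x‖ ≤ n * C := by
    refine (norm_sum_le_of_le _ fun i _ => hC _).trans ?_
    simp
  rw [birkhoffAverage, norm_smul, norm_inv, Real.norm_of_nonneg hn'.le, inv_mul_le_iff₀ hn']
  exact hsum

theorem tendsto_birkhoffAverage_comp_sub {E : Type*} [NormedAddCommGroup E] [NormedSpace ℝ E]
    {g : α → E} {C : ℝ} (hC : ∀ x, ‖g x‖ ≤ C) (x : α) :
    Tendsto (fun n => birkhoffAverage ℝ T g n (T x) - birkhoffAverage ℝ T g n x)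
      atTop (𝓝 0) :=
  tendsto_birkhoffAverage_apply_sub_birkhoffAverage' ℝ
    (isBounded_iff_forall_norm_le.2 ⟨C, by rintro _ ⟨y, rfl⟩; exact hC y⟩) T x

/-- The upper limit of the ergodic averages of a real function. -/
noncomputable def upperMean (T : α → α) (g : α → ℝ) (x : α) : ℝ :=
  limsup (fun n => birkhoffAverage ℝ T g n x) atTop

/-- Averages at x and `T x` have vanishing difference. Invariance holds at every point, not just
almost everywhere, so sets and angles built from upper means are strictly invariant. -/
theorem upperMean_comp {g : α → ℝ} {C : ℝ} (hC : ∀ x, ‖g x‖ ≤ C) (x : α) :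
    upperMean T g (T x) = upperMean T g x :=
  limsup_eq_limsup_of_tendsto_sub (fun n => norm_birkhoffAverage_le hC n _)
    (fun n => norm_birkhoffAverage_le hC n _) (tendsto_birkhoffAverage_comp_sub hC x)

/-- The maximum of `0` and of the first `n` ergodic sums of `g`. -/
noncomputable def maxSum (T : α → α) (g : α → ℝ) : ℕ → α → ℝ
  | 0, _ => 0
  | n + 1, x => max 0 (g x + maxSum T g n (T x))

theorem maxSum_nonneg (g : α → ℝ) (n : ℕ) (x : α) : 0 ≤ maxSum T g n x := by
  cases n with
  | zero => exact le_rfl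
  | succ n => exact le_max_left _ _

theorem maxSum_le_succ (g : α → ℝ) (n : ℕ) (x : α) : maxSum T g n x ≤ maxSum T g (n + 1) x := by
  induction n generalizing x with
  | zero => exact maxSum_nonneg g 1 x
  | succ n ih => exact max_le_max le_rfl (add_le_add le_rfl (ih (T x)))

theorem maxSum_le (g : α → ℝ) {C : ℝ} (hC : ∀ x, |g x| ≤ C) (n : ℕ) (x : α) :
    maxSum T g n x ≤ n * C := by
  have hC0 : 0 ≤ C := (abs_nonneg _).trans (hC x)
  induction n generalizing x with
  | zero => simp [maxSum]
  | succ n ih =>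
    have h1 := (abs_le.1 (hC x)).2
    have h2 := ih (T x)
    have h3 : (0 : ℝ) ≤ n * C := by positivity
    push_cast
    exact max_le (by nlinarith) (by linarith)

theorem birkhoffSum_le_maxSum (g : α → ℝ) (n : ℕ) (x : α) :
    birkhoffSum T g n x ≤ maxSum T g n x := by
  induction n generalizing x with
  | zero => simp [maxSum]
  | succ n ih =>
    rw [birkhoffSum_succ']
    exact le_max_of_le_right (add_le_add le_rfl (ih (T x)))

theorem exists_birkhoffAverage_gt {g : α → ℝ} {C : ℝ} (hC : ∀ x, ‖g x‖ ≤ C) {b : ℝ} {x : α}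
    (h : b < upperMean T g x) : ∃ n, b < birkhoffAverage ℝ T g n x ∧ n ≠ 0 := by
  have hf : ∃ᶠ n in atTop, b < birkhoffAverage ℝ T g n x :=
    frequently_lt_of_lt_limsup (isBoundedUnder_of ⟨-C, fun n =>
      (abs_le.1 (norm_birkhoffAverage_le hC n x)).1⟩ :
      IsBoundedUnder (· ≥ ·) atTop _).isCoboundedUnder_flip h
  exact (hf.and_eventually (eventually_ne_atTop 0)).exists

variable [MeasurableSpace α]

theorem measurable_birkhoffAverage {g : α → ℝ} (hT : Measurable T) (hg : Measurable g) (n : ℕ) :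
    Measurable (birkhoffAverage ℝ T g n) := by
  have : Measurable (fun x => ∑ k ∈ Finset.range n, g (T^[k] x)) :=
    Finset.measurable_sum _ fun k _ => hg.comp (hT.iterate k)
  exact this.const_smul ((n : ℝ)⁻¹)

theorem measurable_upperMean {g : α → ℝ} (hT : Measurable T) (hg : Measurable g) :
    Measurable (upperMean T g) :=
  Measurable.limsup fun n => measurable_birkhoffAverage hT hg n

theorem measurable_maxSum {g : α → ℝ} (hT : Measurable T) (hg : Measurable g) (n : ℕ) :
    Measurable (maxSum T g n) := by
  induction n with
  | zero => exact measurable_const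
  | succ n ih => exact measurable_const.max (hg.add (ih.comp hT))

variable {μ : Measure α} [IsProbabilityMeasure μ]

/-- The maximal ergodic inequality. -/
theorem setIntegral_nonneg_of_maxSum_pos (hT : MeasurePreserving T μ μ) {g : α → ℝ}
    (hg : Measurable g) {C : ℝ} (hC : ∀ x, |g x| ≤ C) (n : ℕ) :
    0 ≤ ∫ x in {x | 0 < maxSum T g n x}, g x ∂μ := by
  have hm := measurable_maxSum hT.measurable hg n
  have hint : Integrable (maxSum T g n) μ :=
    Integrable.of_bound hm.aestronglyMeasurable (n * C) <| ae_of_all _ fun x => by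
      rw [Real.norm_of_nonneg (maxSum_nonneg g n x)]
      exact maxSum_le g hC n x
  have hgint : Integrable g μ :=
    Integrable.of_bound hg.aestronglyMeasurable C (ae_of_all _ hC)
  have hs : MeasurableSet {x | 0 < maxSum T g n x} := measurableSet_lt measurable_const hm
  have hcomp : Integrable (fun x => maxSum T g n (T x)) μ := hT.integrable_comp_of_integrable hint
  -- Garsia's argument: the inequality is pointwise, and the left integral vanishes because T
  -- preserves μ.
  have hle : ∫ x, (maxSum T g n x - maxSum T g n (T x)) ∂μ ≤
      ∫ x, {x | 0 < maxSum T g n x}.indicator g x ∂μ := by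
    refine integral_mono (hint.sub hcomp) (hgint.indicator hs) fun x => ?_
    by_cases hx : 0 < maxSum T g n x
    · rw [Set.indicator_of_mem (by exact hx)]
      cases n with
      | zero => exact absurd hx (lt_irrefl _)
      | succ n =>
        have h1 : maxSum T g (n + 1) x = g x + maxSum T g n (T x) := by
          rcases max_cases (0 : ℝ) (g x + maxSum T g n (T x)) with h | h
          · exact absurd (h.1 ▸ hx : (0 : ℝ) < 0) (lt_irrefl _)
          · exact h.1
        have h2 := maxSum_le_succ (T := T) g n (T x)
        change maxSum T g (n + 1) x - _ ≤ _
        linarith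
    · rw [Set.indicator_of_notMem (by exact hx)]
      have := maxSum_nonneg (T := T) g n (T x)
      change maxSum T g n x - maxSum T g n (T x) ≤ 0
      linarith [not_lt.1 hx]
  rw [integral_indicator hs, integral_sub hint hcomp] at hle
  have heq : ∫ x, maxSum T g n (T x) ∂μ = ∫ x, maxSum T g n x ∂μ := by
    have := integral_map hT.measurable.aemeasurable (μ := μ) (f := maxSum T g n)
      hm.aestronglyMeasurable
    rw [hT.map_eq] at this
    exact this.symm
  linarith

/-- On an invariant set on which the ergodic averages of `g` exceed `b` at some time, the integral
of `g - b` is nonnegative. -/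
theorem setIntegral_sub_nonneg (hT : MeasurePreserving T μ μ) {g : α → ℝ}
    (hg : Measurable g) {C : ℝ} (hC : ∀ x, |g x| ≤ C) {E : Set α} (hE : MeasurableSet E)
    (hinv : ∀ x, T x ∈ E ↔ x ∈ E) (b : ℝ)
    (hb : ∀ x ∈ E, ∃ n, b < birkhoffAverage ℝ T g n x ∧ n ≠ 0) :
    0 ≤ ∫ x in E, (g x - b) ∂μ := by
  -- Cutting off to the invariant set E makes the sets where `maxSum T h n` is positive increase
  -- exactly to E, so the maximal inequality passes to the limit.
  set h : α → ℝ := E.indicator fun x => g x - b with hh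
  have hhm : Measurable h := (hg.sub measurable_const).indicator hE
  have hhC : ∀ x, |h x| ≤ C + |b| := fun x => by
    by_cases hx : x ∈ E
    · rw [hh, Set.indicator_of_mem hx]
      exact (abs_sub _ _).trans (add_le_add (hC x) le_rfl)
    · rw [hh, Set.indicator_of_notMem hx, abs_zero]
      exact add_nonneg ((abs_nonneg _).trans (hC x)) (abs_nonneg _)
  have hit : ∀ (n : ℕ) (x : α), T^[n] x ∈ E ↔ x ∈ E := fun n x => by
    induction n generalizing x with
    | zero => rfl
    | succ n ih => rw [Function.iterate_succ_apply, ih, hinv]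
  have hunion : (⋃ n, {x | 0 < maxSum T h n x}) = E := by
    ext x
    simp only [Set.mem_iUnion, Set.mem_ofPred_eq]
    constructor
    · rintro ⟨n, hn⟩
      by_contra hx
      have : ∀ (n : ℕ) (x : α), x ∉ E → maxSum T h n x = 0 := fun n => by
        induction n with
        | zero => intro x _; rfl
        | succ n ih =>
          intro x hx
          have h1 : h x = 0 := Set.indicator_of_notMem hx _
          change max 0 (h x + maxSum T h n (T x)) = 0
          rw [ih (T x) (by rwa [hinv]), h1]
          simp
      exact hn.ne' (this n x hx)
    · intro hx
      obtain ⟨n, hn, hn0⟩ := hb x hx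
      refine ⟨n, lt_of_lt_of_le ?_ (birkhoffSum_le_maxSum h n x)⟩
      have hsum : birkhoffSum T h n x = birkhoffSum T g n x - n * b := by
        rw [birkhoffSum, birkhoffSum, Finset.sum_congr rfl fun k _ =>
          Set.indicator_of_mem ((hit k x).2 hx) _, Finset.sum_sub_distrib]
        simp
      have hn' : (0 : ℝ) < n := by positivity
      rw [birkhoffAverage, smul_eq_mul, lt_inv_mul_iff₀ hn'] at hn
      linarith
  have hmono : Monotone fun n => {x | 0 < maxSum T h n x} :=
    monotone_nat_of_le_succ fun n x hx => lt_of_lt_of_le hx (maxSum_le_succ h n x)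
  have hhint : Integrable h μ :=
    Integrable.of_bound hhm.aestronglyMeasurable (C + |b|) (ae_of_all _ hhC)
  have hlim := tendsto_setIntegral_of_monotone (μ := μ) (f := h)
    (fun n => measurableSet_lt measurable_const (measurable_maxSum hT.measurable hhm n)) hmono
    hhint.integrableOn
  rw [hunion, setIntegral_congr_fun hE fun x hx => Set.indicator_of_mem hx _] at hlim
  exact ge_of_tendsto' hlim fun n => setIntegral_nonneg_of_maxSum_pos hT hhm hhC n

/-- The pointwise ergodic theorem for bounded real functions. -/
theorem ae_tendsto_birkhoffAverage_upperMean (hT : MeasurePreserving T μ μ) {g : α → ℝ}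
    (hg : Measurable g) {C : ℝ} (hC : ∀ x, ‖g x‖ ≤ C) :
    ∀ᵐ x ∂μ, Tendsto (fun n => birkhoffAverage ℝ T g n x) atTop (𝓝 (upperMean T g x)) := by
  have hCn : ∀ x, ‖(-g) x‖ ≤ C := fun x => by simpa using hC x
  -- Since `-upperMean T (-g)` is the lower limit, the event is lower limit < a < b < upper limit.
  -- Adding the inequalities for g and -g gives 0 ≤ (a - b) μ(E), which forces μ(E) = 0.
  have key : ∀ a b : ℚ, ∀ᵐ x ∂μ,
      ¬ ((a : ℝ) < b ∧ (-a : ℝ) < upperMean T (-g) x ∧ (b : ℝ) < upperMean T g x) := by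
    intro a b
    by_cases hab : (a : ℝ) < b
    swap
    · exact ae_of_all _ fun x hx => hab hx.1
    set E : Set α := {x | (-a : ℝ) < upperMean T (-g) x ∧ (b : ℝ) < upperMean T g x} with hEdef
    have hE : MeasurableSet E :=
      (measurableSet_lt measurable_const (measurable_upperMean hT.measurable hg.neg)).inter
        (measurableSet_lt measurable_const (measurable_upperMean hT.measurable hg))
    have hinv : ∀ x, T x ∈ E ↔ x ∈ E := fun x => by
      simp only [hEdef, Set.mem_ofPred_eq, upperMean_comp hC, upperMean_comp hCn]
    have h1 := setIntegral_sub_nonneg hT hg hC hE hinv b fun x hx =>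
      exists_birkhoffAverage_gt hC hx.2
    have h2 := setIntegral_sub_nonneg hT hg.neg hCn hE hinv (-a) fun x hx =>
      exists_birkhoffAverage_gt hCn hx.1
    have hgint : Integrable g μ := Integrable.of_bound hg.aestronglyMeasurable C (ae_of_all _ hC)
    have hsum : (∫ x in E, (g x - b) ∂μ) + ∫ x in E, ((-g) x - (-a)) ∂μ
        = ((a : ℝ) - b) * μ.real E := by
      have hadd := integral_add (μ := μ.restrict E) (f := fun x => g x - b)
        (g := fun x => (-g) x - (-a)) (hgint.integrableOn.sub (integrable_const _))
        (hgint.neg.integrableOn.sub (integrable_const _))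
      rw [← hadd, integral_congr_ae (g := fun _ => (a : ℝ) - b)
        (ae_of_all _ fun x => by simp only [Pi.neg_apply]; ring)]
      simp [mul_comm]
    have hzero : μ.real E = 0 := by
      refine le_antisymm ?_ measureReal_nonneg
      by_contra hpos
      nlinarith [not_le.1 hpos]
    have hμ : μ E = 0 := (measureReal_eq_zero_iff).1 hzero
    filter_upwards [measure_eq_zero_iff_ae_notMem.1 hμ] with x hx hx'
    exact hx hx'.2
  filter_upwards [ae_all_iff.2 fun a => ae_all_iff.2 (key a)] with x hx
  have hb : ∀ (h : α → ℝ), (∀ x, ‖h x‖ ≤ C) →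
      IsBoundedUnder (· ≤ ·) atTop fun n => birkhoffAverage ℝ T h n x := fun h hh =>
    isBoundedUnder_of ⟨C, fun n => (abs_le.1 (norm_birkhoffAverage_le hh n x)).2⟩
  have hle : -upperMean T (-g) x ≥ upperMean T g x := by
    by_contra hlt
    obtain ⟨a, ha1, ha2⟩ := exists_rat_btwn (not_le.1 hlt)
    obtain ⟨b, hb1, hb2⟩ := exists_rat_btwn ha2
    exact hx a b ⟨hb1, by linarith, hb2⟩
  refine tendsto_order.2 ⟨fun c hc => ?_, fun c hc => eventually_lt_of_limsup_lt hc (hb g hC)⟩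
  have : upperMean T (-g) x < -c := by linarith
  filter_upwards [eventually_lt_of_limsup_lt this (hb _ hCn)] with n hn
  rw [birkhoffAverage_neg] at hn
  simp only [Pi.neg_apply] at hn
  linarith

end Birkhoff

/-! ### The ergodic theorem for complex functions -/

section ComplexBirkhoff

variable {α : Type*} {T : α → α}

/-- The limit of the ergodic averages of a bounded complex function, where it exists. -/
noncomputable def ergodicMean (T : α → α) (g : α → ℂ) (x : α) : ℂ :=
  ⟨upperMean T (fun y => (g y).re) x, upperMean T (fun y => (g y).im) x⟩

theorem ergodicMean_comp {g : α → ℂ} {C : ℝ} (hC : ∀ x, ‖g x‖ ≤ C) (x : α) :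
    ergodicMean T g (T x) = ergodicMean T g x := by
  unfold ergodicMean
  rw [upperMean_comp fun y => (Complex.abs_re_le_norm _).trans (hC y),
    upperMean_comp fun y => (Complex.abs_im_le_norm _).trans (hC y)]

theorem birkhoffAverage_eq_re_im (g : α → ℂ) (n : ℕ) (x : α) :
    birkhoffAverage ℝ T g n x = ⟨birkhoffAverage ℝ T (fun y => (g y).re) n x,
      birkhoffAverage ℝ T (fun y => (g y).im) n x⟩ := by
  apply Complex.ext <;> simp [birkhoffAverage, birkhoffSum]

variable [MeasurableSpace α]

theorem measurable_ergodicMean (hT : Measurable T) {g : α → ℂ} (hg : Measurable g) :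
    Measurable (ergodicMean T g) := by
  have h1 := measurable_upperMean hT (Complex.measurable_re.comp hg)
  have h2 := measurable_upperMean hT (Complex.measurable_im.comp hg)
  exact Complex.measurableEquivRealProd.symm.measurable.comp (h1.prodMk h2)

variable {μ : Measure α} [IsProbabilityMeasure μ]

/-- The pointwise ergodic theorem for bounded complex functions. -/
theorem ae_tendsto_birkhoffAverage_ergodicMean (hT : MeasurePreserving T μ μ) {g : α → ℂ}
    (hg : Measurable g) {C : ℝ} (hC : ∀ x, ‖g x‖ ≤ C) :
    ∀ᵐ x ∂μ, Tendsto (fun n => birkhoffAverage ℝ T g n x) atTop (𝓝 (ergodicMean T g x)) := by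
  filter_upwards [ae_tendsto_birkhoffAverage_upperMean hT (Complex.measurable_re.comp hg)
      fun y => (Complex.abs_re_le_norm _).trans (hC y),
    ae_tendsto_birkhoffAverage_upperMean hT (Complex.measurable_im.comp hg)
      fun y => (Complex.abs_im_le_norm _).trans (hC y)] with x h1 h2
  have h := (Complex.equivRealProdCLM.symm.continuous.tendsto _).comp (h1.prodMk_nhds h2)
  refine h.congr fun n => ?_
  rw [birkhoffAverage_eq_re_im]
  rfl

end ComplexBirkhoff

/-! ### Twisting by an invariant angle: skew products -/

section Twisted

variable {α : Type*} {T : α → α}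

/-- The average `(1 / k) ∑_{j < k} θ ^ j * f (T^j x)`. -/
noncomputable def twistedAvg (T : α → α) (f : α → ℂ) (θ : Circle) (k : ℕ) (x : α) : ℂ :=
  (k : ℂ)⁻¹ * ∑ j ∈ Finset.range k, (θ : ℂ) ^ j * f (T^[j] x)

theorem norm_twistedAvg_le {f : α → ℂ} {C : ℝ} (hC : ∀ x, ‖f x‖ ≤ C) (θ : Circle) (k : ℕ)
    (x : α) : ‖twistedAvg T f θ k x‖ ≤ C := by
  have hC0 : 0 ≤ C := (norm_nonneg _).trans (hC x)
  rcases Nat.eq_zero_or_pos k with rfl | hk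
  · simpa [twistedAvg] using hC0
  have hk' : (0 : ℝ) < k := by exact_mod_cast hk
  rw [twistedAvg, norm_mul, norm_inv, Complex.norm_natCast, inv_mul_le_iff₀ hk']
  have hj : ∀ j ∈ Finset.range k, ‖(θ : ℂ) ^ j * f (T^[j] x)‖ ≤ C := fun j _ => by
    simpa [Circle.norm_coe] using hC _
  exact (norm_sum_le_of_le _ hj).trans (by simp)

variable [MeasurableSpace α] {μ : Measure α} [IsProbabilityMeasure μ]

/-- Averages twisted by an invariant angle converge almost everywhere. -/
theorem ae_exists_tendsto_twistedAvg (hT : MeasurePreserving T μ μ) {f : α → ℂ}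
    (hf : Measurable f) {C : ℝ} (hC : ∀ x, ‖f x‖ ≤ C) {t : α → ℝ} (ht : Measurable t)
    (hinv : ∀ x, t (T x) = t x) :
    ∀ᵐ x ∂μ, ∃ l, Tendsto (fun k => twistedAvg T f (Circle.exp (t x)) k x) atTop (𝓝 l) := by
  have : Fact (0 < 2 * Real.pi) := ⟨Real.two_pi_pos⟩
  let ν : Measure (AddCircle (2 * Real.pi)) := AddCircle.haarAddCircle
  -- As t is constant along orbits, n steps of S rotate the fibre by n t(x); the character in F then
  -- produces the twist θ ^ n.
  let S : α × AddCircle (2 * Real.pi) → α × AddCircle (2 * Real.pi) :=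
    fun p => (T p.1, (t p.1 : AddCircle (2 * Real.pi)) + p.2)
  have htm : Measurable fun x => (t x : AddCircle (2 * Real.pi)) :=
    (AddCircle.measurable_mk').comp ht
  have hS : MeasurePreserving S (μ.prod ν) (μ.prod ν) :=
    hT.skew_product (g := fun x z => (t x : AddCircle (2 * Real.pi)) + z)
      ((htm.comp measurable_fst).add measurable_snd)
      (ae_of_all _ fun x => map_add_left_eq_self ν _)
  let F : α × AddCircle (2 * Real.pi) → ℂ := fun p => (AddCircle.toCircle p.2 : ℂ) * f p.1
  have hF : Measurable F :=
    ((continuous_induced_dom.comp AddCircle.continuous_toCircle).measurable.comp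
      measurable_snd).mul (hf.comp measurable_fst)
  have hFC : ∀ p, ‖F p‖ ≤ C := fun p => by simpa [F, Circle.norm_coe] using hC p.1
  have hit : ∀ (n : ℕ) (x : α) (z : AddCircle (2 * Real.pi)),
      F (S^[n] (x, z)) = AddCircle.toCircle z * ((Circle.exp (t x) : ℂ) ^ n * f (T^[n] x)) := by
    intro n
    induction n with
    | zero => intro x z; simp [F]
    | succ n ih =>
      intro x z
      rw [Function.iterate_succ_apply, Function.iterate_succ_apply]
      change F (S^[n] (T x, _ + z)) = _
      rw [ih, hinv, AddCircle.toCircle_add, AddCircle.toCircle_apply_mk]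
      have : 2 * Real.pi / (2 * Real.pi) * t x = t x := by
        rw [div_self Real.two_pi_pos.ne', one_mul]
      rw [this, Circle.coe_mul, pow_succ]
      ring
  have hae := Measure.ae_ae_of_ae_prod (ae_tendsto_birkhoffAverage_ergodicMean hS hF hFC)
  filter_upwards [hae] with x hx
  -- One z suffices: it enters the averages only as a nonzero constant factor.
  obtain ⟨z, hz⟩ := hx.exists
  refine ⟨(AddCircle.toCircle z : ℂ)⁻¹ * ergodicMean S F (x, z),
    (hz.const_mul (AddCircle.toCircle z : ℂ)⁻¹).congr fun k => ?_⟩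
  have hz0 : (AddCircle.toCircle z : ℂ) ≠ 0 := Circle.coe_ne_zero _
  rw [birkhoffAverage, birkhoffSum, Finset.sum_congr rfl fun n _ => hit n x z,
    ← Finset.mul_sum, twistedAvg, Complex.real_smul]
  push_cast
  field_simp

end Twisted

/-! ### Smoothing of twisted averages -/

section VanDerCorput

variable {α : Type*} {T : α → α}

/-- Shifting the window by m changes the mean by O(m / k); averaging over the shifts m < M produces
the M-term averages along the orbit. -/
theorem tendsto_twistedAvg_sub {f : α → ℂ} {C : ℝ} (hC : ∀ x, ‖f x‖ ≤ C) (θ : Circle) {M : ℕ}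
    (hM : M ≠ 0) (x : α) :
    Tendsto (fun k : ℕ => twistedAvg T f θ k x -
      (k : ℂ)⁻¹ * ∑ n ∈ Finset.range k, (θ : ℂ) ^ n * twistedAvg T f θ M (T^[n] x))
      atTop (𝓝 0) := by
  set c : ℕ → ℂ := fun n => (θ : ℂ) ^ n * f (T^[n] x) with hc
  have hcC : ∀ n, ‖c n‖ ≤ C := fun n => by simpa [hc, Circle.norm_coe] using hC _
  set s : ℕ → ℕ → ℂ := fun m k => (k : ℂ)⁻¹ * ∑ n ∈ Finset.range k, c (n + m) with hs
  have hstep : ∀ m, Tendsto (fun k => s m k - s (m + 1) k) atTop (𝓝 0) := fun m => by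
    have hlim : Tendsto (fun k : ℕ => (2 * C) / (k : ℝ)) atTop (𝓝 0) :=
      tendsto_const_nhds.div_atTop tendsto_natCast_atTop_atTop
    refine squeeze_zero_norm (fun k => ?_) hlim
    have : s m k - s (m + 1) k = (k : ℂ)⁻¹ * (c m - c (k + m)) := by
      rw [hs]
      dsimp only
      rw [← mul_sub, ← Finset.sum_sub_distrib]
      congr 1
      have := Finset.sum_range_sub' (fun n => c (n + m)) k
      simp only [zero_add] at this
      rw [← this]
      exact Finset.sum_congr rfl fun n _ => by rw [show n + (m + 1) = n + 1 + m by ring]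
    rw [this, norm_mul, norm_inv, Complex.norm_natCast, div_eq_inv_mul]
    gcongr
    linarith [norm_sub_le (c m) (c (k + m)), hcC m, hcC (k + m)]
  have hshift : ∀ m, Tendsto (fun k => s 0 k - s m k) atTop (𝓝 0) := fun m => by
    induction m with
    | zero => simp
    | succ m ih => simpa using ih.add (hstep m)
  have hsum : Tendsto (fun k => (M : ℂ)⁻¹ * ∑ m ∈ Finset.range M, (s 0 k - s m k))
      atTop (𝓝 0) := by
    simpa using (tendsto_finsetSum (Finset.range M) fun m _ => hshift m).const_mul (M : ℂ)⁻¹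
  refine hsum.congr fun k => ?_
  rw [Finset.sum_sub_distrib, mul_sub]
  congr 1
  · have hM' : (M : ℂ) ≠ 0 := by exact_mod_cast hM
    simp only [Finset.sum_const, Finset.card_range, nsmul_eq_mul, hs, hc, twistedAvg, add_zero]
    field_simp
  · simp only [hs, twistedAvg, Finset.mul_sum]
    rw [Finset.sum_comm]
    refine Finset.sum_congr rfl fun n _ => Finset.sum_congr rfl fun m _ => ?_
    simp only [hc]
    rw [add_comm n m, Function.iterate_add_apply, pow_add]
    ring

theorem norm_sq_twisted_mean_le (θ : Circle) (u : ℕ → ℂ) (k : ℕ) :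
    ‖(k : ℂ)⁻¹ * ∑ n ∈ Finset.range k, (θ : ℂ) ^ n * u n‖ ^ 2 ≤
      (k : ℝ)⁻¹ * ∑ n ∈ Finset.range k, ‖u n‖ ^ 2 := by
  rcases Nat.eq_zero_or_pos k with rfl | hk
  · simp
  have hk' : (0 : ℝ) < k := by exact_mod_cast hk
  have h1 : ‖∑ n ∈ Finset.range k, (θ : ℂ) ^ n * u n‖ ≤ ∑ n ∈ Finset.range k, ‖u n‖ :=
    norm_sum_le_of_le _ fun n _ => by simp [Circle.norm_coe]
  have h2 : (∑ n ∈ Finset.range k, ‖u n‖) ^ 2 ≤ k * ∑ n ∈ Finset.range k, ‖u n‖ ^ 2 := by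
    simpa using sq_sum_le_card_mul_sum_sq (s := Finset.range k) (f := fun n => ‖u n‖)
  rw [norm_mul, norm_inv, Complex.norm_natCast, mul_pow, inv_pow, inv_mul_le_iff₀ (by positivity)]
  calc _ ≤ (∑ n ∈ Finset.range k, ‖u n‖) ^ 2 := by gcongr
    _ ≤ _ := h2
    _ = _ := by field_simp

end VanDerCorput

/-! ### Almost orthogonality and the large sieve -/

section Sieve

variable {α : Type*} {T : α → α}

theorem tendsto_mean_pow {ω : Circle} (hω : ω ≠ 1) :
    Tendsto (fun M : ℕ => (M : ℝ)⁻¹ * ‖∑ j ∈ Finset.range M, (ω : ℂ) ^ j‖) atTop (𝓝 0) := by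
  have hω' : (ω : ℂ) ≠ 1 := fun h => hω (Circle.coe_eq_one.1 h)
  have hpos : 0 < ‖(ω : ℂ) - 1‖ := norm_pos_iff.2 (sub_ne_zero.2 hω')
  have hlim : Tendsto (fun M : ℕ => (2 / ‖(ω : ℂ) - 1‖) / (M : ℝ)) atTop (𝓝 0) :=
    tendsto_const_nhds.div_atTop tendsto_natCast_atTop_atTop
  refine squeeze_zero (fun M => by positivity) (fun M => ?_) hlim
  rw [geom_sum_eq hω', norm_div, div_eq_inv_mul (2 / _)]
  gcongr
  refine (norm_sub_le _ _).trans ?_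
  simp [Circle.norm_coe]
  norm_num

open Classical in
/-- The defect of orthogonality of the first `M` powers of the points of `F`. -/
noncomputable def gramDefect (F : Finset Circle) (M : ℕ) : ℝ :=
  ∑ θ ∈ F, ∑ φ ∈ F.erase θ, (M : ℝ)⁻¹ * ‖∑ j ∈ Finset.range M, ((θ⁻¹ * φ : Circle) : ℂ) ^ j‖

theorem tendsto_gramDefect (F : Finset Circle) : Tendsto (gramDefect F) atTop (𝓝 0) := by
  classical
  have : Tendsto (gramDefect F) atTop (𝓝 (∑ θ ∈ F, ∑ φ ∈ F.erase θ, 0)) := by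
    refine tendsto_finsetSum _ fun θ _ => tendsto_finsetSum _ fun φ hφ => tendsto_mean_pow ?_
    intro h
    exact Finset.ne_of_mem_erase hφ (inv_mul_eq_one.1 h).symm
  simpa using this

/-- A large sieve inequality for twisted averages. -/
theorem sum_norm_sq_twistedAvg_le {f : α → ℂ} {C : ℝ} (hC : ∀ x, ‖f x‖ ≤ C) (F : Finset Circle)
    {M : ℕ} (hM : M ≠ 0) (y : α) :
    ∑ θ ∈ F, ‖twistedAvg T f θ M y‖ ^ 2 ≤ C ^ 2 * (1 + gramDefect F M) := by
  classical
  have hM0 : (0 : ℝ) < M := by positivity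
  have hMC : (M : ℂ) ≠ 0 := by exact_mod_cast hM
  set A : Circle → ℂ := fun θ => twistedAvg T f θ M y with hA
  have hAC : ∀ θ, ‖A θ‖ ≤ C := fun θ => norm_twistedAvg_le hC θ M y
  set a : ℕ → ℂ := fun j => f (T^[j] y) with ha
  -- Bessel's argument: b is the approximate projection of a onto the characters in F. In 0 ≤ ∑ |a -
  -- b|², the cross sum is M ∑ |A|², and ∑ |b|² exceeds it only by off-diagonal terms.
  set b : ℕ → ℂ := fun j => ∑ θ ∈ F, A θ * ((θ⁻¹ : Circle) : ℂ) ^ j with hb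
  set D : Circle → Circle → ℂ := fun θ φ => ∑ j ∈ Finset.range M, ((θ⁻¹ * φ : Circle) : ℂ) ^ j
    with hD
  have hconj : ∀ j, (starRingEnd ℂ) (b j) = ∑ θ ∈ F, (starRingEnd ℂ) (A θ) * (θ : ℂ) ^ j :=
    fun j => by
      rw [hb]
      dsimp only
      rw [map_sum]
      refine Finset.sum_congr rfl fun θ _ => ?_
      rw [map_mul, map_pow, ← Circle.coe_inv_eq_conj, inv_inv]
  have hab : ∑ j ∈ Finset.range M, a j * (starRingEnd ℂ) (b j)
      = ((M * ∑ θ ∈ F, ‖A θ‖ ^ 2 : ℝ) : ℂ) := by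
    rw [Finset.sum_congr rfl fun j _ => by rw [hconj, Finset.mul_sum], Finset.sum_comm]
    push_cast
    rw [Finset.mul_sum]
    refine Finset.sum_congr rfl fun θ _ => ?_
    rw [← Complex.conj_mul']
    have : (M : ℂ) * A θ = ∑ j ∈ Finset.range M, (θ : ℂ) ^ j * a j := by
      simp only [hA, twistedAvg]
      rw [mul_inv_cancel_left₀ hMC]
    rw [mul_left_comm, this, Finset.mul_sum]
    exact Finset.sum_congr rfl fun j _ => by ring
  have hbb : ∑ j ∈ Finset.range M, b j * (starRingEnd ℂ) (b j)
      = ∑ θ ∈ F, ∑ φ ∈ F, A θ * (starRingEnd ℂ) (A φ) * D θ φ := by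
    rw [Finset.sum_congr rfl fun j _ => by rw [hconj, hb, Finset.sum_mul_sum], Finset.sum_comm]
    refine Finset.sum_congr rfl fun θ _ => ?_
    rw [Finset.sum_comm]
    refine Finset.sum_congr rfl fun φ _ => ?_
    rw [hD, Finset.mul_sum]
    refine Finset.sum_congr rfl fun j _ => ?_
    rw [Circle.coe_mul, mul_pow]
    ring
  have hbb_le : ∑ j ∈ Finset.range M, ‖b j‖ ^ 2 ≤
      M * ∑ θ ∈ F, ‖A θ‖ ^ 2 + C ^ 2 * (M * gramDefect F M) := by
    have h1 : ((∑ j ∈ Finset.range M, ‖b j‖ ^ 2 : ℝ) : ℂ) =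
        ∑ θ ∈ F, ∑ φ ∈ F, A θ * (starRingEnd ℂ) (A φ) * D θ φ := by
      rw [← hbb]
      push_cast
      exact Finset.sum_congr rfl fun j _ => (Complex.mul_conj' _).symm
    have h2 : ∑ j ∈ Finset.range M, ‖b j‖ ^ 2 =
        ‖∑ θ ∈ F, ∑ φ ∈ F, A θ * (starRingEnd ℂ) (A φ) * D θ φ‖ := by
      rw [← h1, Complex.norm_real, Real.norm_of_nonneg (by positivity)]
    rw [h2, gramDefect, Finset.mul_sum, Finset.mul_sum, Finset.mul_sum, ← Finset.sum_add_distrib]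
    refine norm_sum_le_of_le _ fun θ hθ => ?_
    rw [← Finset.add_sum_erase F _ hθ, Finset.mul_sum _ _ (M : ℝ),
      Finset.mul_sum _ _ (C ^ 2)]
    refine (norm_add_le _ _).trans (add_le_add ?_ (norm_sum_le_of_le _ fun φ _ => ?_))
    · rw [norm_mul, norm_mul, RCLike.norm_conj]
      simp [hD]
      exact le_of_eq (by ring)
    · rw [norm_mul, norm_mul, RCLike.norm_conj, mul_inv_cancel_left₀ hM0.ne', sq]
      exact mul_le_mul_of_nonneg_right (mul_le_mul (hAC θ) (hAC φ) (norm_nonneg _)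
        ((norm_nonneg _).trans (hAC θ))) (norm_nonneg _)
  have haa : ∑ j ∈ Finset.range M, ‖a j‖ ^ 2 ≤ M * C ^ 2 := by
    refine (Finset.sum_le_sum fun j _ => pow_le_pow_left₀ (norm_nonneg _)
      (hC (T^[j] y)) 2).trans (by simp)
  have hre : ∑ j ∈ Finset.range M, (a j * (starRingEnd ℂ) (b j)).re
      = M * ∑ θ ∈ F, ‖A θ‖ ^ 2 := by
    rw [← Complex.re_sum, hab, Complex.ofReal_re]
  have hexp : 0 ≤ ∑ j ∈ Finset.range M,
      (‖a j‖ ^ 2 + ‖b j‖ ^ 2 - 2 * (a j * (starRingEnd ℂ) (b j)).re) := by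
    refine Finset.sum_nonneg fun j _ => ?_
    rw [Complex.sq_norm, Complex.sq_norm, ← Complex.normSq_sub]
    exact Complex.normSq_nonneg _
  rw [Finset.sum_sub_distrib, Finset.sum_add_distrib, ← Finset.mul_sum, hre] at hexp
  have hfin : (M : ℝ) * ∑ θ ∈ F, ‖A θ‖ ^ 2 ≤ M * (C ^ 2 * (1 + gramDefect F M)) := by
    nlinarith
  exact le_of_mul_le_mul_left hfin hM0

end Sieve

/-! ### Spectral means and the finiteness of large angles -/

section SpectralMean

variable {α : Type*} {T : α → α}

/-- The product `f ∘ T^i` times the conjugate of `f ∘ T^j`. -/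
noncomputable def corr (T : α → α) (f : α → ℂ) (i j : ℕ) (y : α) : ℂ :=
  f (T^[i] y) * (starRingEnd ℂ) (f (T^[j] y))

theorem norm_corr_le {f : α → ℂ} {C : ℝ} (hC : ∀ x, ‖f x‖ ≤ C) (i j : ℕ) (y : α) :
    ‖corr T f i j y‖ ≤ C * C := by
  rw [corr, norm_mul, RCLike.norm_conj]
  exact mul_le_mul (hC _) (hC _) (norm_nonneg _) ((norm_nonneg _).trans (hC y))

/-- The ergodic mean of `‖twistedAvg T f θ M‖ ^ 2`, expressed through the ergodic means of
correlations. -/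
noncomputable def spectralMean (T : α → α) (f : α → ℂ) (M : ℕ) (x : α) (θ : Circle) : ℝ :=
  (((M : ℂ) ^ 2)⁻¹ * ∑ i ∈ Finset.range M, ∑ j ∈ Finset.range M,
    (θ : ℂ) ^ i * (starRingEnd ℂ) ((θ : ℂ) ^ j) * ergodicMean T (corr T f i j) x).re

theorem continuous_spectralMean (f : α → ℂ) (M : ℕ) (x : α) :
    Continuous (spectralMean T f M x) := by
  have : Continuous ((↑) : Circle → ℂ) := continuous_induced_dom
  refine Complex.continuous_re.comp (continuous_const.mul (continuous_finsetSum _ fun i _ =>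
    continuous_finsetSum _ fun j _ => ?_))
  exact ((this.pow i).mul (Complex.continuous_conj.comp (this.pow j))).mul continuous_const

theorem spectralMean_comp {f : α → ℂ} {C : ℝ} (hC : ∀ x, ‖f x‖ ≤ C) (M : ℕ) (x : α) :
    spectralMean T f M (T x) = spectralMean T f M x := by
  funext θ
  simp only [spectralMean, ergodicMean_comp (norm_corr_le hC _ _)]

/-- A point at which the ergodic averages of all correlations of `f` converge. -/
def IsRegularPoint (T : α → α) (f : α → ℂ) (x : α) : Prop :=
  ∀ i j : ℕ, Tendsto (fun n => birkhoffAverage ℝ T (corr T f i j) n x) atTop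
    (𝓝 (ergodicMean T (corr T f i j) x))

theorem norm_sq_twistedAvg (f : α → ℂ) (M : ℕ) (θ : Circle) (y : α) :
    ((‖twistedAvg T f θ M y‖ ^ 2 : ℝ) : ℂ) = ((M : ℂ) ^ 2)⁻¹ * ∑ i ∈ Finset.range M,
      ∑ j ∈ Finset.range M, (θ : ℂ) ^ i * (starRingEnd ℂ) ((θ : ℂ) ^ j) * corr T f i j y := by
  push_cast
  rw [← Complex.mul_conj', twistedAvg, map_mul, map_sum, map_inv₀, Complex.conj_natCast,
    mul_mul_mul_comm, Finset.sum_mul_sum, sq, mul_inv]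
  congr 1
  refine Finset.sum_congr rfl fun i _ => Finset.sum_congr rfl fun j _ => ?_
  rw [map_mul, corr]
  ring

/-- The squared modulus expands into finitely many correlations, so countably many limits at x serve
all M and all θ at once. -/
theorem IsRegularPoint.tendsto_spectralMean {f : α → ℂ} {x : α} (hx : IsRegularPoint T f x)
    (M : ℕ) (θ : Circle) :
    Tendsto (fun n : ℕ => (n : ℝ)⁻¹ * ∑ k ∈ Finset.range n, ‖twistedAvg T f θ M (T^[k] x)‖ ^ 2)
      atTop (𝓝 (spectralMean T f M x θ)) := by
  have hlim : Tendsto (fun n => ((M : ℂ) ^ 2)⁻¹ * ∑ i ∈ Finset.range M, ∑ j ∈ Finset.range M,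
      (θ : ℂ) ^ i * (starRingEnd ℂ) ((θ : ℂ) ^ j) * birkhoffAverage ℝ T (corr T f i j) n x)
      atTop (𝓝 (((M : ℂ) ^ 2)⁻¹ * ∑ i ∈ Finset.range M, ∑ j ∈ Finset.range M,
      (θ : ℂ) ^ i * (starRingEnd ℂ) ((θ : ℂ) ^ j) * ergodicMean T (corr T f i j) x)) :=
    (tendsto_finsetSum _ fun i _ => tendsto_finsetSum _ fun j _ =>
      (hx i j).const_mul _).const_mul _
  refine ((Complex.continuous_re.tendsto _).comp hlim).congr fun n => ?_
  rw [Function.comp_apply, ← Complex.ofReal_re ((n : ℝ)⁻¹ * _)]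
  congr 1
  rw [Complex.ofReal_mul, Complex.ofReal_sum]
  simp only [norm_sq_twistedAvg, birkhoffAverage, birkhoffSum, Complex.real_smul, Finset.mul_sum]
  rw [Finset.sum_comm (s := Finset.range n)]
  refine Finset.sum_congr rfl fun i _ => ?_
  rw [Finset.sum_comm (s := Finset.range n)]
  refine Finset.sum_congr rfl fun j _ => Finset.sum_congr rfl fun k _ => ?_
  ring

/-- Averaging the large sieve along the orbit and letting M → ∞ bounds the number of such angles by
C² / ε. The index M + 1 avoids the empty average, whose mean is 0. -/
theorem IsRegularPoint.finite_setOf_le_spectralMean {f : α → ℂ} {C : ℝ} (hC : ∀ x, ‖f x‖ ≤ C)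
    {x : α} (hx : IsRegularPoint T f x) {ε : ℝ} (hε : 0 < ε) :
    {θ : Circle | ∀ M : ℕ, ε ≤ spectralMean T f (M + 1) x θ}.Finite := by
  by_contra hinf
  obtain ⟨n, hn⟩ := exists_nat_gt (C ^ 2 / ε)
  obtain ⟨F, hF, hcard⟩ := (Set.not_finite.1 hinf).exists_subset_card_eq n
  have hle : ∀ M : ℕ, n * ε ≤ C ^ 2 * (1 + gramDefect F (M + 1)) := fun M => by
    have h1 : (n : ℝ) * ε ≤ ∑ θ ∈ F, spectralMean T f (M + 1) x θ := by
      rw [← hcard, ← nsmul_eq_mul]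
      exact Finset.card_nsmul_le_sum _ _ _ fun θ hθ => hF hθ M
    refine h1.trans (le_of_tendsto (tendsto_finsetSum F fun θ _ =>
      hx.tendsto_spectralMean (M + 1) θ) ?_)
    filter_upwards [eventually_gt_atTop 0] with N hN
    have hN' : (0 : ℝ) < N := by exact_mod_cast hN
    rw [← Finset.mul_sum, Finset.sum_comm, inv_mul_le_iff₀ hN']
    refine (Finset.sum_le_sum fun k _ => sum_norm_sq_twistedAvg_le hC F
      (Nat.succ_ne_zero M) (T^[k] x)).trans (by simp)
  have hlim : Tendsto (fun M => C ^ 2 * (1 + gramDefect F (M + 1))) atTop (𝓝 (C ^ 2)) := by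
    simpa using (((tendsto_gramDefect F).comp (tendsto_add_atTop_nat 1)).const_add 1).const_mul
      (C ^ 2)
  have := ge_of_tendsto' hlim hle
  rw [div_lt_iff₀ hε] at hn
  linarith

/-- If the spectral means are arbitrarily small at `θ`, the twisted averages tend to `0`. -/
theorem IsRegularPoint.tendsto_twistedAvg_zero {f : α → ℂ} {C : ℝ} (hC : ∀ x, ‖f x‖ ≤ C)
    {x : α} (hx : IsRegularPoint T f x) {θ : Circle}
    (h : ∀ ε > 0, ∃ M : ℕ, spectralMean T f (M + 1) x θ < ε) :
    Tendsto (fun k => twistedAvg T f θ k x) atTop (𝓝 0) := by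
  rw [Metric.tendsto_atTop']
  intro ε hε
  obtain ⟨M, hM⟩ := h ((ε / 2) ^ 2) (by positivity)
  have h1 := (hx.tendsto_spectralMean (M + 1) θ).eventually_lt_const hM
  have h2 := (tendsto_twistedAvg_sub (T := T) hC θ (Nat.succ_ne_zero M) x).norm.eventually_lt_const
    (by simpa using half_pos hε : ‖(0 : ℂ)‖ < ε / 2)
  obtain ⟨N, hN⟩ := eventually_atTop.1 (h1.and h2)
  refine ⟨N, fun k hk => ?_⟩
  obtain ⟨h3, h4⟩ := hN k hk.le
  have h5 := lt_of_pow_lt_pow_left₀ 2 (half_pos hε).le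
    ((norm_sq_twisted_mean_le θ (fun n => twistedAvg T f θ (M + 1) (T^[n] x)) k).trans_lt h3)
  rw [dist_zero_right]
  have h6 := norm_le_norm_add_norm_sub' (twistedAvg T f θ k x)
    ((k : ℂ)⁻¹ * ∑ n ∈ Finset.range k, (θ : ℂ) ^ n * twistedAvg T f θ (M + 1) (T^[n] x))
  linarith

variable [MeasurableSpace α]

theorem measurable_corr (hT : Measurable T) {f : α → ℂ} (hf : Measurable f) (i j : ℕ) :
    Measurable (corr T f i j) :=
  (hf.comp (hT.iterate i)).mul
    (Complex.continuous_conj.measurable.comp (hf.comp (hT.iterate j)))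

theorem measurable_spectralMean (hT : Measurable T) {f : α → ℂ} (hf : Measurable f) (M : ℕ)
    (θ : Circle) : Measurable fun x => spectralMean T f M x θ :=
  Complex.measurable_re.comp (measurable_const.mul (Finset.measurable_sum _ fun i _ =>
    Finset.measurable_sum _ fun j _ =>
      measurable_const.mul (measurable_ergodicMean hT (measurable_corr hT hf i j))))

theorem ae_isRegularPoint {μ : Measure α} [IsProbabilityMeasure μ] (hT : MeasurePreserving T μ μ)
    {f : α → ℂ} (hf : Measurable f) {C : ℝ} (hC : ∀ x, ‖f x‖ ≤ C) :
    ∀ᵐ x ∂μ, IsRegularPoint T f x :=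
  ae_all_iff.2 fun i => ae_all_iff.2 fun j => ae_tendsto_birkhoffAverage_ergodicMean hT
    (measurable_corr hT.measurable hf i j) (norm_corr_le hC i j)

end SpectralMean

/-! ### Measurable selection of exceptional angles -/

section FirstHit

/-- Continuity moves an exact solution to the countable dense set D at the price of slack 1 / (N +
1) in finitely many constraints; compactness of K recovers an exact one as N → ∞. -/
theorem measurableSet_exists_mem_forall_le {α : Type*} [MeasurableSpace α] {Φ : ℕ → α → ℝ → ℝ}
    (hΦm : ∀ M t, Measurable fun x => Φ M x t) (hΦc : ∀ M x, Continuous (Φ M x)) {K : Set ℝ}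
    (hK : IsCompact K) (ε : ℝ) : MeasurableSet {x | ∃ t ∈ K, ∀ M, ε ≤ Φ M x t} := by
  obtain ⟨D, hDK, hDc, hD⟩ :=
    (TopologicalSpace.IsSeparable.of_separableSpace K).exists_countable_dense_subset
  have heq : {x | ∃ t ∈ K, ∀ M, ε ≤ Φ M x t} =
      ⋂ N : ℕ, ⋃ t ∈ D, ⋂ m ∈ Finset.range (N + 1), {x | ε - 1 / ((N : ℝ) + 1) < Φ m x t} := by
    ext x
    simp only [Set.mem_iInter, Set.mem_iUnion, Set.mem_ofPred_eq, exists_prop, Finset.mem_range]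
    constructor
    · rintro ⟨t, htK, ht⟩ N
      have hopen : IsOpen {s | ∀ m ∈ Finset.range (N + 1), ε - 1 / ((N : ℝ) + 1) < Φ m x s} := by
        have : {s | ∀ m ∈ Finset.range (N + 1), ε - 1 / ((N : ℝ) + 1) < Φ m x s} =
            ⋂ m ∈ Finset.range (N + 1), {s | ε - 1 / ((N : ℝ) + 1) < Φ m x s} := by
          ext s; simp
        rw [this]
        exact isOpen_biInter_finset fun m _ => isOpen_lt continuous_const (hΦc m x)
      have hpos : 0 < 1 / ((N : ℝ) + 1) := by positivity
      obtain ⟨s, hs, hsD⟩ := mem_closure_iff.1 (hD htK) _ hopen fun m _ => by linarith [ht m]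
      exact ⟨s, hsD, fun m hm => hs m (Finset.mem_range.2 hm)⟩
    · intro h
      choose t htD ht using h
      obtain ⟨s, hsK, φ, hφ, hlim⟩ := hK.tendsto_subseq fun N => hDK (htD N)
      refine ⟨s, hsK, fun m => ?_⟩
      have h1 : Tendsto (fun N => ε - 1 / ((φ N : ℝ) + 1)) atTop (𝓝 (ε - 0)) :=
        (tendsto_one_div_add_atTop_nhds_zero_nat.comp hφ.tendsto_atTop).const_sub ε
      rw [sub_zero] at h1
      refine le_of_tendsto_of_tendsto h1 (((hΦc m x).tendsto s).comp hlim) ?_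
      filter_upwards [eventually_ge_atTop m] with N hN
      exact (ht (φ N) m (Nat.lt_succ_of_le (hN.trans (hφ.id_le N)))).le
  rw [heq]
  exact MeasurableSet.iInter fun N => MeasurableSet.biUnion hDc fun t _ =>
    Finset.measurableSet_biInter _ fun m _ => measurableSet_lt measurable_const (hΦm m t)

/-- The least `t ∈ [q, 4]` at which all functions of the sequence are at least `ε`, and `4` if
there is none. -/
noncomputable def firstHit (ψ : ℕ → ℝ → ℝ) (ε q : ℝ) : ℝ :=
  sInf (insert 4 {t | t ∈ Set.Icc q 4 ∧ ∀ M, ε ≤ ψ M t})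

theorem bddBelow_firstHit (ψ : ℕ → ℝ → ℝ) (ε q : ℝ) :
    BddBelow (insert 4 {t | t ∈ Set.Icc q 4 ∧ ∀ M, ε ≤ ψ M t}) :=
  BddBelow.insert _ ⟨q, fun _ ht => ht.1.1⟩

theorem firstHit_le_iff {ψ : ℕ → ℝ → ℝ} (hψ : ∀ M, Continuous (ψ M)) (ε q : ℝ) {s : ℝ}
    (hs : s < 4) : firstHit ψ ε q ≤ s ↔ ∃ t ∈ Set.Icc q s, ∀ M, ε ≤ ψ M t := by
  constructor
  · intro h
    -- Closedness makes the infimum attained; s < 4 then rules out the default value.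
    have hcl : IsClosed (insert 4 {t | t ∈ Set.Icc q 4 ∧ ∀ M, ε ≤ ψ M t}) := by
      rw [Set.insert_eq]
      refine isClosed_singleton.union (isClosed_Icc.inter ?_)
      have : {t | ∀ M, ε ≤ ψ M t} = ⋂ M, {t | ε ≤ ψ M t} := by ext; simp
      change IsClosed {t | ∀ M, ε ≤ ψ M t}
      rw [this]
      exact isClosed_iInter fun M => isClosed_le continuous_const (hψ M)
    rcases hcl.csInf_mem ⟨4, Set.mem_insert _ _⟩ (bddBelow_firstHit ψ ε q) with h4 | hmem
    · exact absurd (h4 ▸ h : (4 : ℝ) ≤ s) (not_le.2 hs)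
    · exact ⟨_, ⟨hmem.1.1, h⟩, hmem.2⟩
  · rintro ⟨t, ht, hM⟩
    exact (csInf_le (bddBelow_firstHit ψ ε q)
      (Set.mem_insert_of_mem _ ⟨⟨ht.1, ht.2.trans hs.le⟩, hM⟩)).trans ht.2

theorem measurable_firstHit {α : Type*} [MeasurableSpace α] {Φ : ℕ → α → ℝ → ℝ}
    (hΦm : ∀ M t, Measurable fun x => Φ M x t) (hΦc : ∀ M x, Continuous (Φ M x)) (ε q : ℝ) :
    Measurable fun x => firstHit (fun M => Φ M x) ε q := by
  refine measurable_of_Iic fun s => ?_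
  rcases lt_or_ge s 4 with hs | hs
  · have : (fun x => firstHit (fun M => Φ M x) ε q) ⁻¹' Set.Iic s =
        {x | ∃ t ∈ Set.Icc q s, ∀ M, ε ≤ Φ M x t} := by
      ext x
      exact firstHit_le_iff (fun M => hΦc M x) ε q hs
    rw [this]
    exact measurableSet_exists_mem_forall_le hΦm hΦc isCompact_Icc ε
  · have : (fun x => firstHit (fun M => Φ M x) ε q) ⁻¹' Set.Iic s = Set.univ :=
      Set.eq_univ_of_forall fun x =>
        (csInf_le (bddBelow_firstHit _ ε q) (Set.mem_insert _ _)).trans hs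
    rw [this]
    exact MeasurableSet.univ

/-- An isolated point of a level set on the circle is a first hit from a rational angle. -/
theorem exists_firstHit_eq_arg {ψ : ℕ → Circle → ℝ} {ε : ℝ}
    (hfin : {θ : Circle | ∀ M, ε ≤ ψ M θ}.Finite) {θ : Circle} (hθ : ∀ M, ε ≤ ψ M θ) :
    ∃ q : ℚ, Circle.exp (firstHit (fun M t => ψ M (Circle.exp t)) ε q) = θ := by
  set a : ℝ := Complex.arg θ with ha
  -- The cap 4 lies above every argument, so it cannot hide the hit at a.
  have haπ : a ≤ 4 := (Complex.arg_le_pi _).trans Real.pi_le_four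
  set P : Set ℝ := {t | -Real.pi < t ∧ t < a ∧ ∀ M, ε ≤ ψ M (Circle.exp t)} with hP
  have hPfin : P.Finite := by
    refine (hfin.image fun φ : Circle => Complex.arg φ).subset fun t ht => ?_
    exact ⟨Circle.exp t, ht.2.2, Circle.arg_exp ht.1 (ht.2.1.le.trans (Complex.arg_le_pi _))⟩
  -- Finiteness of P leaves a gap to the left of a; a rational q in the gap has a as its first hit.
  have hnhds : Pᶜ ∩ Set.Ioi (-Real.pi) ∈ 𝓝 a :=
    inter_mem (hPfin.isClosed.isOpen_compl.mem_nhds fun h => lt_irrefl _ h.2.1)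
      (Ioi_mem_nhds (Complex.neg_pi_lt_arg _))
  obtain ⟨l, hl, hsub⟩ := exists_Ioc_subset_of_mem_nhds hnhds (exists_lt a)
  obtain ⟨q, hlq, hqa⟩ := exists_rat_btwn hl
  have hexp : Circle.exp a = θ := Circle.exp_arg θ
  refine ⟨q, ?_⟩
  suffices h : firstHit (fun M t => ψ M (Circle.exp t)) ε q = a by rw [h, hexp]
  refine le_antisymm (csInf_le (bddBelow_firstHit _ ε q) (Set.mem_insert_of_mem _
    ⟨⟨hqa.le, haπ⟩, fun M => (hexp.symm ▸ hθ M : ε ≤ ψ M (Circle.exp a))⟩))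
    (le_csInf ⟨4, Set.mem_insert _ _⟩ ?_)
  rintro t (rfl | ⟨ht, hM⟩)
  · exact haπ
  · by_contra hlt
    have hmem := hsub ⟨hlq.trans_le ht.1, (not_le.1 hlt).le⟩
    exact hmem.1 ⟨hmem.2, not_le.1 hlt, hM⟩

end FirstHit

/-- The Wiener–Wintner theorem for bounded functions. -/
theorem ae_forall_exists_tendsto_twistedAvg {α : Type*} [MeasurableSpace α] {T : α → α}
    {μ : Measure α} [IsProbabilityMeasure μ] (hT : MeasurePreserving T μ μ) {f : α → ℂ}
    (hf : Measurable f) {C : ℝ} (hC : ∀ x, ‖f x‖ ≤ C) :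
    ∀ᵐ x ∂μ, ∀ θ : Circle, ∃ l, Tendsto (fun k => twistedAvg T f θ k x) atTop (𝓝 l) := by
  -- Countably many levels and starting points cover all exceptional angles; where no hit occurs,
  -- the default 4 is still an invariant angle.
  set τ : ℕ → ℚ → α → ℝ := fun n q x =>
    firstHit (fun M t => spectralMean T f (M + 1) x (Circle.exp t)) (1 / ((n : ℝ) + 1)) q with hτ
  have hτm : ∀ n q, Measurable (τ n q) := fun n q =>
    measurable_firstHit (Φ := fun M x t => spectralMean T f (M + 1) x (Circle.exp t))
      (fun M t => measurable_spectralMean hT.measurable hf _ _)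
      (fun M x => (continuous_spectralMean f _ x).comp Circle.exp.continuous) _ _
  have hτT : ∀ n q x, τ n q (T x) = τ n q x := fun n q x => by
    simp only [hτ, spectralMean_comp hC]
  filter_upwards [ae_isRegularPoint hT hf hC, ae_all_iff.2 fun n => ae_all_iff.2 fun q =>
    ae_exists_tendsto_twistedAvg hT hf hC (hτm n q) (hτT n q)] with x hx hconv θ
  by_cases h : ∀ ε > 0, ∃ M : ℕ, spectralMean T f (M + 1) x θ < ε
  · exact ⟨0, hx.tendsto_twistedAvg_zero hC h⟩
  push Not at h
  obtain ⟨ε, hε, hle⟩ := h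
  obtain ⟨n, hn⟩ := exists_nat_one_div_lt hε
  obtain ⟨q, hq⟩ := exists_firstHit_eq_arg
    (ψ := fun M θ => spectralMean T f (M + 1) x θ)
    (hx.finite_setOf_le_spectralMean hC (by positivity : 0 < 1 / ((n : ℝ) + 1)))
    fun M => hn.le.trans (hle M)
  have := hconv n q
  simp only [hτ] at this
  rwa [hq] at this

/-! ### Comparison of spatial averages with values at the centre -/

section Comparison

variable {X : Type*}

theorem weightedAvg_initialSegment [TopologicalSpace X] (T : X ≃ₜ X) (f : X → ℂ) (θ : Circle)
    (k : ℕ) (x : X) :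
    weightedAvg T (initialSegment k) (fun _ => θ) f x = twistedAvg T f θ k x := by
  have hit : ∀ (n : ℕ) (y : X), (T ^ (n : ℤ)) y = T^[n] y := fun n => by
    rw [zpow_natCast]
    induction n with
    | zero => intro y; rfl
    | succ n ih =>
      intro y
      rw [pow_succ, Function.iterate_succ_apply, ← ih]
      rfl
  have hseg : initialSegment k = (Finset.range k).map Nat.castEmbedding := by
    ext j
    simp only [initialSegment, Finset.mem_Ico, Finset.mem_map, Finset.mem_range,
      Nat.castEmbedding_apply]
    constructor
    · rintro ⟨h0, hk⟩
      exact ⟨j.toNat, by omega, by omega⟩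
    · rintro ⟨n, hn, rfl⟩
      omega
  rw [weightedAvg, twistedAvg, hseg, Finset.sum_map, Finset.card_map, Finset.card_range]
  congr 1
  refine Finset.sum_congr rfl fun n _ => ?_
  rw [Nat.castEmbedding_apply, hit, zpow_natCast, Circle.coe_pow]

theorem norm_spatialAvg_sub_le [MeasurableSpace X] {μ : Measure X} [IsFiniteMeasure μ]
    {C : Set X} (hC : 0 < μ C) {g : X → ℂ} (hg : Integrable g μ) {z : ℂ}
    {B : ℝ} (hB : ∀ y ∈ C, ‖g y - z‖ ≤ B) : ‖spatialAvg μ C g - z‖ ≤ B := by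
  have hpos : 0 < μ.real C := ENNReal.toReal_pos hC.ne' (measure_ne_top _ _)
  have hne : ((μ.real C : ℝ) : ℂ) ≠ 0 := by exact_mod_cast hpos.ne'
  have heq : spatialAvg μ C g - z = ((μ.real C : ℝ) : ℂ)⁻¹ * ∫ y in C, (g y - z) ∂μ := by
    rw [integral_sub hg.integrableOn (integrable_const z), setIntegral_const, spatialAvg,
      Complex.real_smul]
    field_simp
  rw [heq, norm_mul, norm_inv, Complex.norm_real, Real.norm_of_nonneg hpos.le,
    inv_mul_le_iff₀ hpos, mul_comm]
  exact norm_setIntegral_le_of_norm_le_const (measure_lt_top _ _) hB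

theorem dist_le_dilation [MetricSpace X] [CompactSpace X] (T : X ≃ₜ X) (x : X) (j : ℤ) {r : ℝ}
    {y : X} (hy : dist x y ≤ r) : dist ((T ^ j) x) ((T ^ j) y) ≤ dilation T x j r := by
  refine le_csSup ⟨Metric.diam (Set.univ : Set X), ?_⟩ ⟨y, hy, rfl⟩
  rintro _ ⟨z, -, rfl⟩
  exact Metric.dist_le_diam_of_mem isCompact_univ.isBounded (Set.mem_univ _) (Set.mem_univ _)

theorem continuous_weightedAvg_const [TopologicalSpace X] (T : X ≃ₜ X) (F : Finset ℤ) (θ : Circle)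
    {f : X → ℂ} (hf : Continuous f) : Continuous (weightedAvg T F (fun _ => θ) f) :=
  continuous_const.mul (continuous_finsetSum _ fun j _ =>
    continuous_const.mul (hf.comp (T ^ j).continuous))

/-- Times of small dilation contribute at most ε each, the others at most 2C more; the bound is
uniform over the ball of radius r. -/
theorem norm_weightedAvg_sub_le [MetricSpace X] [CompactSpace X] (T : X ≃ₜ X) {f : X → ℂ} {C : ℝ}
    (hC : ∀ x, ‖f x‖ ≤ C) {ε δ : ℝ} (hε : 0 ≤ ε)
    (hδ : ∀ x y, dist x y ≤ δ → ‖f x - f y‖ ≤ ε) (θ : Circle) {k : ℕ} (hk : k ≠ 0) {x y : X}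
    {r : ℝ} (hxy : dist x y ≤ r) :
    ‖weightedAvg T (initialSegment k) (fun _ => θ) f y -
        weightedAvg T (initialSegment k) (fun _ => θ) f x‖ ≤
      ε + 2 * C * ((({j : ℤ | j ∈ initialSegment k ∧ δ < dilation T x j r}.ncard : ℕ) : ℝ) / k) := by
  classical
  have hk0 : (0 : ℝ) < k := by positivity
  have hC0 : 0 ≤ C := (norm_nonneg _).trans (hC x)
  have hcard : (initialSegment k).card = k := by simp [initialSegment]
  have hncard : {j : ℤ | j ∈ initialSegment k ∧ δ < dilation T x j r}.ncard =
      ((initialSegment k).filter fun j => δ < dilation T x j r).card := by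
    rw [← Set.ncard_coe_finset]
    congr 1
    ext j
    simp
  have hterm : ∀ j ∈ initialSegment k,
      ‖((θ ^ j : Circle) : ℂ) * f ((T ^ j) y) - ((θ ^ j : Circle) : ℂ) * f ((T ^ j) x)‖ ≤
        ε + 2 * C * if δ < dilation T x j r then 1 else 0 := fun j _ => by
    rw [← mul_sub, norm_mul, Circle.norm_coe, one_mul]
    split_ifs with h
    · have := norm_sub_le (f ((T ^ j) y)) (f ((T ^ j) x))
      linarith [hC ((T ^ j) y), hC ((T ^ j) x)]
    · rw [norm_sub_rev, mul_zero, add_zero]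
      exact hδ _ _ ((dist_le_dilation T x j hxy).trans (not_lt.1 h))
  rw [weightedAvg, weightedAvg, ← mul_sub, ← Finset.sum_sub_distrib, norm_mul, norm_inv,
    Complex.norm_natCast, hcard, inv_mul_le_iff₀ hk0]
  refine (norm_sum_le_of_le _ hterm).trans (le_of_eq ?_)
  rw [Finset.sum_add_distrib, ← Finset.mul_sum, Finset.sum_boole, hncard, Finset.sum_const, hcard]
  rw [nsmul_eq_mul]
  field_simp

end Comparison

end TemporoSpatial

theorem mainTheorem12 {X : Type*} [MetricSpace X] [CompactSpace X] [MeasurableSpace X]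
    [BorelSpace X] (T : X ≃ₜ X) (μ : Measure X) [IsProbabilityMeasure μ]
    (hT : MeasurePreserving T μ μ)
    (Δ : ℤ → Set.Ioo (0 : ℝ) 1 → Set.Ioi (0 : ℝ))
    (hΔ : ∀ j : ℤ, TemporoSpatial.IsModulusOfUniformEquicontinuity (Δ j)
      (TemporoSpatial.powFamily (TemporoSpatial.constantWeights X) j))
    (C : ℕ → X → Set X)
    (hC_meas : ∀ k : ℕ, 1 ≤ k → ∀ x : X, MeasurableSet (C k x))
    (hC_pos : ∀ k : ℕ, 1 ≤ k → ∀ x : X, 0 < μ (C k x))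
    (hC_mem : ∀ k : ℕ, 1 ≤ k → ∀ x : X, x ∈ C k x)
    (hC_dilation : ∀ x : X, ∀ δ : ℝ, 0 < δ →
      Tendsto (fun k : ℕ =>
        (({j : ℤ | j ∈ TemporoSpatial.initialSegment k ∧
          δ < TemporoSpatial.dilation T x j (Metric.diam (C k x))}.ncard : ℕ) : ℝ) / (k : ℝ))
        atTop (𝓝 0))
    (hC_modulus : ∀ x : X, ∀ ε : Set.Ioo (0 : ℝ) 1,
      Tendsto (fun k : ℕ =>
        (({j : ℤ | j ∈ TemporoSpatial.initialSegment k ∧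
          (Δ j ε : ℝ) < Metric.diam (C k x)}.ncard : ℕ) : ℝ) / (k : ℝ))
        atTop (𝓝 0))
    (f : C(X, ℂ)) :
    ∃ Xf : Set X, MeasurableSet Xf ∧ μ Xf = 1 ∧
      ∀ x ∈ Xf, ∀ θ : Circle, ∃ l : ℂ,
        Tendsto (fun k : ℕ =>
          TemporoSpatial.spatialAvg μ (C k x)
            (TemporoSpatial.weightedAvg T (TemporoSpatial.initialSegment k) (fun _ => θ) f))
          atTop (𝓝 l) := by

  obtain ⟨K, hK⟩ : ∃ K, ∀ x, ‖f x‖ ≤ K := ⟨‖f‖, f.norm_coe_le_norm⟩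
  have hae := TemporoSpatial.ae_forall_exists_tendsto_twistedAvg hT f.continuous.measurable hK
  -- The condition over uncountably many θ need not be visibly measurable, so the complement of a
  -- measurable hull of the bad set is used.
  refine ⟨(toMeasurable μ {x | ¬ ∀ θ : Circle, ∃ l, Tendsto
    (fun k => TemporoSpatial.twistedAvg T f θ k x) atTop (𝓝 l)})ᶜ,
    (measurableSet_toMeasurable _ _).compl, ?_, fun x hx θ => ?_⟩
  · rw [prob_compl_eq_one_iff (measurableSet_toMeasurable _ _), measure_toMeasurable]
    exact hae
  have hx' : ∀ θ : Circle, ∃ l, Tendsto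
      (fun k => TemporoSpatial.twistedAvg T f θ k x) atTop (𝓝 l) := by
    by_contra h
    exact hx (subset_toMeasurable _ _ h)
  obtain ⟨l, hl⟩ := hx' θ
  refine ⟨l, ?_⟩
  have hK0 : 0 ≤ K := (norm_nonneg _).trans (hK x)
  suffices hsub : Tendsto (fun k : ℕ => TemporoSpatial.spatialAvg μ (C k x)
      (TemporoSpatial.weightedAvg T (TemporoSpatial.initialSegment k) (fun _ => θ) f) -
      TemporoSpatial.twistedAvg T f θ k x) atTop (𝓝 0) by
    simpa using hsub.add hl
  rw [Metric.tendsto_atTop']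
  intro ε hε
  obtain ⟨δ, hδ, hfδ⟩ := Metric.uniformContinuous_iff.1
    (CompactSpace.uniformContinuous_of_continuous f.continuous) (ε / 2) (half_pos hε)
  -- Halving δ turns the non-strict distance bound into the strict one of uniform continuity.
  have hlim : Tendsto (fun k : ℕ => ε / 2 + 2 * K *
      ((({j : ℤ | j ∈ TemporoSpatial.initialSegment k ∧
        δ / 2 < TemporoSpatial.dilation T x j (Metric.diam (C k x))}.ncard : ℕ) : ℝ) / (k : ℝ)))
      atTop (𝓝 (ε / 2)) := by
    simpa using ((hC_dilation x (δ / 2) (half_pos hδ)).const_mul (2 * K)).const_add (ε / 2)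
  obtain ⟨N, hN⟩ := eventually_atTop.1 (hlim.eventually_lt_const (half_lt_self hε))
  refine ⟨N, fun k hk => ?_⟩
  -- The strict inequality k > N excludes k = 0, where nothing is known about `C k x`.
  have hk1 : 1 ≤ k := by omega
  rw [dist_zero_right, ← TemporoSpatial.weightedAvg_initialSegment]
  refine (TemporoSpatial.norm_spatialAvg_sub_le (hC_pos k hk1 x) ?_
    fun y hy => ?_).trans_lt (hN k hk.le)
  · exact (TemporoSpatial.continuous_weightedAvg_const T _ θ
      f.continuous).integrable_of_hasCompactSupport (HasCompactSupport.of_compactSpace _)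
  · refine TemporoSpatial.norm_weightedAvg_sub_le T hK (half_pos hε).le (fun u v huv => ?_) θ
      (by omega) (Metric.dist_le_diam_of_mem (isCompact_univ.isBounded.subset
        (Set.subset_univ _)) (hC_mem k hk1 x) hy)
    rw [← dist_eq_norm]
    exact (hfδ (huv.trans_lt (half_lt_self hδ))).le
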